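/- Let $G=(V,E)$ be a planar $st$-digraph with $n$ vertices: a finite simple acyclic digraph with exactly one source $s$ and exactly one sink $t$, together with a planar embedding (the set of faces, with the face boundaries and the external face, of a planar drawing) in which $s$ and $t$ lie on the boundary of the external face. An acyclic HP-completion set of $G$ is a set $E_c$ of directed edges not in $E$ such that $G'=(V,E\cup E_c)$ is acyclic and has a Hamiltonian path from $s$ to $t$ that contains every edge of $E_c$. It is drawn by an upward drawing $\Gamma(G')$ of $G'$ (every edge is a simple arc that increases strictly in the vertical direction, and passes through no vertex other than its end-vertices) such that deleting the edges of $E_c$ leaves a planar drawing of $G$ with the given embedding. The crossings of $\Gamma(G')$ are the common interior points of pairs of distinct edges. The pair $(E_c,\Gamma(G'))$ is crossing-optimal if its number of crossings is minimum over all acyclic HP-completion sets of $G$ and all such drawings of them. An upward topological 2-page book embedding of $G$ is an upward planar drawing of $G$ with the given embedding in which all vertices lie on a vertical line (the spine); edges may pass from one side of the spine to the other. Its spine crossings are the points, other than end-vertices, that edges have in common with the spine. It is optimal if its number of spine crossings is minimum over all upward topological 2-page book embeddings of $G$. Then for every ordering $(v_1,\dots,v_n)$ of $V$ and every integer $c\ge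 0$, the following are equivalent: (i) $G$ has a crossing-optimal acyclic HP-completion set $E_c$, with corresponding optimal drawing $\Gamma(G')$, such that the Hamiltonian path is $(s=v_1,v_2,\dots,v_n=t)$ and $\Gamma(G')$ has exactly $c$ crossings; (ii) $G$ has an optimal upward topological 2-page book embedding with exactly $c$ spine crossings in which the vertices appear on the spine, from bottom to top, in the order $(s=v_1,v_2,\dots,v_n=t)$. -/

import Mathlib

namespace Digraph

/-- The Euclidean plane, with horizontal coordinate `p.1` and vertical coordinate `p.2`. -/
abbrev Plane : Type := ℝ × ℝ

/-- The edges of a digraph: an edge `e` is directed from `e.1.1` to `e.1.2`. -/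
abbrev Edge {V : Type*} (G : Digraph V) : Type _ := {e : V × V // G.Adj e.1 e.2}

/-- No directed closed walk of positive length. -/
def Acyclic {V : Type*} (G : Digraph V) : Prop :=
  ∀ u, ¬ Relation.TransGen G.Adj u u

/-- `v` has in-degree zero. -/
def IsSource {V : Type*} (G : Digraph V) (v : V) : Prop :=
  ∀ u, ¬ G.Adj u v

/-- `v` has out-degree zero. -/
def IsSink {V : Type*} (G : Digraph V) (v : V) : Prop :=
  ∀ u, ¬ G.Adj v u

/-- A drawing of a digraph: the vertices are distinct points of the plane, and every edge is a
simple Jordan arc from the point of its tail to the point of its head whose relative interior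
contains no vertex. Different edges may intersect. -/
structure Drawing {V : Type*} (G : Digraph V) where
  point : V → Plane
  curve : G.Edge → C(unitInterval, Plane)
  point_injective : Function.Injective point
  curve_zero : ∀ e, curve e 0 = point e.1.1
  curve_one : ∀ e, curve e 1 = point e.1.2
  curve_injective : ∀ e, Function.Injective (curve e)
  curve_avoids : ∀ e w τ, curve e τ = point w → τ = 0 ∨ τ = 1

namespace Drawing

variable {V : Type*} {G : Digraph V}

/-- The drawing obtained by deleting the edges that do not belong to the spanning subgraph `H`. -/
def restrict {H : Digraph V} (Γ : G.Drawing) (h : H ≤ G) : H.Drawing where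
  point := Γ.point
  curve e := Γ.curve ⟨e.1, h e.2⟩
  point_injective := Γ.point_injective
  curve_zero _ := Γ.curve_zero _
  curve_one _ := Γ.curve_one _
  curve_injective _ := Γ.curve_injective _
  curve_avoids _ := Γ.curve_avoids _

/-- The curve of an edge, without its two end-vertices. -/
def openArc (Γ : G.Drawing) (e : G.Edge) : Set Plane :=
  Γ.curve e '' Set.Ioo 0 1

/-- Two distinct edges never meet except at end-vertices. -/
def IsPlanar (Γ : G.Drawing) : Prop :=
  ∀ e f, e ≠ f → Disjoint (Γ.openArc e) (Γ.openArc f)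

/-- Every edge increases strictly in the vertical direction. -/
def IsUpward (Γ : G.Drawing) : Prop :=
  ∀ e, StrictMono fun τ => (Γ.curve e τ).2

/-- The edge crossings of a drawing: unordered pairs of distinct edges, together with a point that
is interior to both of them. -/
def crossings (Γ : G.Drawing) : Set (Sym2 G.Edge × Plane) :=
  {x | ∃ e f, e ≠ f ∧ x.1 = s(e, f) ∧ x.2 ∈ Γ.openArc e ∩ Γ.openArc f}

/-- The set of points of the plane that are occupied by the drawing. -/
def support (Γ : G.Drawing) : Set Plane :=
  Set.range Γ.point ∪ ⋃ e, Set.range (Γ.curve e)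

/-- The faces: the connected components of the complement of the drawing. -/
def faces (Γ : G.Drawing) : Set (Set Plane) :=
  {F | ∃ p ∈ Γ.supportᶜ, F = connectedComponentIn Γ.supportᶜ p}

/-- The vertices on the boundary of a face. -/
def boundaryVertices (Γ : G.Drawing) (F : Set Plane) : Set V :=
  {v | Γ.point v ∈ frontier F}

/-- The edges on the boundary of a face. -/
def boundaryEdges (Γ : G.Drawing) (F : Set Plane) : Set G.Edge :=
  {e | Set.range (Γ.curve e) ⊆ frontier F}

/-- Two drawings define the same set of faces: their faces correspond to each other in such a way
that corresponding faces have the same boundary, and external (unbounded) faces correspond to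
external faces. For planar drawings this says that they induce the same embedded graph. -/
def SameFaces (Γ Δ : G.Drawing) : Prop :=
  ∃ σ : Γ.faces ≃ Δ.faces, ∀ F : Γ.faces,
    Δ.boundaryVertices (σ F) = Γ.boundaryVertices F ∧
    Δ.boundaryEdges (σ F) = Γ.boundaryEdges F ∧
    (Bornology.IsBounded (σ F : Set Plane) ↔ Bornology.IsBounded (F : Set Plane))

/-- `Γ` represents a planar st-digraph with source `s` and sink `t`: it is a planar drawing of an
acyclic digraph whose only source is `s` and whose only sink is `t`, and both of them lie on the
boundary of the external face. -/
structure IsPlanarST (Γ : G.Drawing) (s t : V) : Prop where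
  planar : Γ.IsPlanar
  acyclic : G.Acyclic
  source_iff : ∀ v, G.IsSource v ↔ v = s
  sink_iff : ∀ v, G.IsSink v ↔ v = t
  external : ∃ F ∈ Γ.faces, ¬ Bornology.IsBounded F ∧
    s ∈ Γ.boundaryVertices F ∧ t ∈ Γ.boundaryVertices F

end Drawing

/-- `v 0, v 1, …, v (n - 1)` is a Hamiltonian path of `G` from `s` to `t`. -/
structure IsHamiltonianPath {V : Type*} (G : Digraph V) (s t : V) {n : ℕ} (v : Fin n ≃ V) :
    Prop where
  adj : ∀ i j : Fin n, (j : ℕ) = i + 1 → G.Adj (v i) (v j)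
  first : ∀ i : Fin n, (i : ℕ) = 0 → v i = s
  last : ∀ i : Fin n, (i : ℕ) + 1 = n → v i = t

/-- The edge set of `C` is an acyclic HP-completion set of `G` with Hamiltonian path `v`: the edges
of `C` are not edges of `G`, the HP-completed digraph `G ⊔ C` is acyclic, `v` is a Hamiltonian
path of it from `s` to `t`, and all edges of `C` are part of that path. -/
structure IsAcyclicHPCompletion {V : Type*} (G C : Digraph V) (s t : V) {n : ℕ}
    (v : Fin n ≃ V) : Prop where
  new : ∀ u w, C.Adj u w → ¬ G.Adj u w
  acyclic : (G ⊔ C).Acyclic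
  hamiltonian : (G ⊔ C).IsHamiltonianPath s t v
  on_path : ∀ u w, C.Adj u w → ∃ i j : Fin n, (j : ℕ) = i + 1 ∧ v i = u ∧ v j = w

namespace Drawing

variable {V : Type*} {G : Digraph V}

/-- `Γ` preserves the embedded planar graph represented by `Γ₀`: after the deletion of the edges
that are not in `G` it is a planar drawing with the same faces as `Γ₀`. -/
def Preserves {C : Digraph V} (Γ : (G ⊔ C).Drawing) (Γ₀ : G.Drawing) : Prop :=
  (Γ.restrict (le_sup_left : G ≤ G ⊔ C)).IsPlanar ∧
    (Γ.restrict (le_sup_left : G ≤ G ⊔ C)).SameFaces Γ₀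

/-- `C` is an acyclic HP-completion set, with Hamiltonian path `v`, of the embedded digraph that is
represented by `Γ₀`, and `Γ` is an upward drawing of the HP-completed digraph that preserves the
embedding. -/
structure IsHPDrawing (Γ₀ : G.Drawing) (s t : V) {n : ℕ} (v : Fin n ≃ V) (C : Digraph V)
    (Γ : (G ⊔ C).Drawing) : Prop where
  completion : G.IsAcyclicHPCompletion C s t v
  upward : Γ.IsUpward
  preserves : Γ.Preserves Γ₀

/-- `C`, drawn by `Γ`, is a crossing-optimal acyclic HP-completion set: the number of crossings is
minimum over all acyclic HP-completion sets and all their drawings. -/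
def IsOptimalHPDrawing (Γ₀ : G.Drawing) (s t : V) {n : ℕ} (v : Fin n ≃ V) (C : Digraph V)
    (Γ : (G ⊔ C).Drawing) : Prop :=
  IsHPDrawing Γ₀ s t v C Γ ∧
    ∀ (w : Fin n ≃ V) (D : Digraph V) (Δ : (G ⊔ D).Drawing), IsHPDrawing Γ₀ s t w D Δ →
      Γ.crossings.encard ≤ Δ.crossings.encard

/-- `Γ` is an upward topological 2-page book embedding of the embedded digraph represented by `Γ₀`.
The spine is the vertical line `x = 0`, the pages are the two closed half-planes bounded by it, all
vertices are on the spine, all edges are upward, no two edges cross, and the embedding is that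
of `Γ₀`. Edges may pass from one page to the other. -/
structure IsUpwardBookEmbedding (Γ₀ Γ : G.Drawing) : Prop where
  on_spine : ∀ v, (Γ.point v).1 = 0
  upward : Γ.IsUpward
  planar : Γ.IsPlanar
  sameFaces : Γ.SameFaces Γ₀

/-- The spine crossings: the points, other than end-vertices, that the edges have in common with
the spine `x = 0`. -/
def spineCrossings (Γ : G.Drawing) : Set (G.Edge × Plane) :=
  {x | x.2 ∈ Γ.openArc x.1 ∧ x.2.1 = 0}

/-- From bottom to top, the vertices appear in the order `v 0, v 1, …, v (n - 1)`. -/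
def HasSpineOrder (Γ : G.Drawing) {n : ℕ} (v : Fin n ≃ V) : Prop :=
  StrictMono fun i => (Γ.point (v i)).2

/-- An upward topological 2-page book embedding with the minimum number of spine crossings, over
all upward topological 2-page book embeddings of the same embedded digraph. -/
def IsOptimalBookEmbedding (Γ₀ Γ : G.Drawing) : Prop :=
  IsUpwardBookEmbedding Γ₀ Γ ∧
    ∀ Δ : G.Drawing, IsUpwardBookEmbedding Γ₀ Δ →
      Γ.spineCrossings.encard ≤ Δ.spineCrossings.encard

end Drawing

end Digraph

open Set

/-! For each fixed vertex order, either kind of drawing yields one of the other kind with at most as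
many crossings. The two minima therefore agree, and both constructions carry optimal drawings to
optimal drawings with the same order and count.

From completion to book (`IsHPDrawing.exists_bookEmbedding`): the Hamiltonian path is upward and
visits every vertex, so it is almost a spine. Where it uses an edge of `C`, the spine follows that
edge; where it uses an edge of `G`, the spine runs beside it, too close to meet any edge of `G`. The
result is a graph `x = x(y)`, straightened by the height-preserving homeomorphism `(x, y) ↦ (x -
x(y), y)`. Each spine crossing comes from a crossing of an edge of `G` with an edge of `C`.

From book to completion (`addSpine`): consecutive nonadjacent vertices are joined by segments of the
spine. Every crossing is then one of an edge of `G` with such a segment, hence a spine crossing.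
Acyclicity is automatic because the drawing is upward. -/

/-- By compactness the injective projection to heights is a closed embedding, so Tietze's theorem
applies. -/
theorem IsCompact.exists_continuous_eq_fst {K : Set (ℝ × ℝ)} (hK : IsCompact K)
    (hinj : InjOn Prod.snd K) : ∃ h : C(ℝ, ℝ), ∀ p ∈ K, h p.2 = p.1 := by
  have : CompactSpace K := isCompact_iff_compactSpace.mp hK
  have hemb : Topology.IsClosedEmbedding (fun p : K => (p : ℝ × ℝ).2) :=
    (continuous_snd.comp continuous_subtype_val).isClosedEmbedding
      (injOn_iff_injective.mp hinj)
  obtain ⟨h, hh⟩ := ContinuousMap.exists_extension hemb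
    (⟨fun p : K => (p : ℝ × ℝ).1, by fun_prop⟩ : C(K, ℝ))
  exact ⟨h, fun p hp => congrArg (fun k : C(K, ℝ) => k ⟨p, hp⟩) hh⟩

/-- A continuous bump on `[a, b]` that stays below finitely many functions without zeros. -/
theorem exists_continuous_pos_lt_abs {ι : Type*} [Finite ι] {a b : ℝ} (F : ι → C(ℝ, ℝ))
    (hF : ∀ k, ∀ y ∈ Ioo a b, F k y ≠ 0) :
    ∃ g : C(ℝ, ℝ), g a = 0 ∧ g b = 0 ∧ ∀ y ∈ Ioo a b, 0 < g y ∧ ∀ k, g y < |F k y| := by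
  classical
  have := Fintype.ofFinite ι
  suffices H : ∀ s : Finset ι, ∃ g : C(ℝ, ℝ), g a = 0 ∧ g b = 0 ∧
      ∀ y ∈ Ioo a b, 0 < g y ∧ ∀ k ∈ s, g y < |F k y| by
    obtain ⟨g, ha, hb, hg⟩ := H Finset.univ
    exact ⟨g, ha, hb, fun y hy => ⟨(hg y hy).1, fun k => (hg y hy).2 k (Finset.mem_univ k)⟩⟩
  intro s
  induction s using Finset.induction_on with
  | empty =>
    refine ⟨⟨fun y => (y - a) * (b - y), by fun_prop⟩, by simp, by simp, fun y hy => ⟨?_, by simp⟩⟩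
    exact mul_pos (sub_pos.mpr hy.1) (sub_pos.mpr hy.2)
  | insert k s _ ih =>
    obtain ⟨g, ha, hb, hg⟩ := ih
    -- Halving makes the new bound strict.
    refine ⟨⟨fun y => min (g y) (|F k y| / 2), by fun_prop⟩, ?_, ?_, fun y hy => ?_⟩
    · simp only [ContinuousMap.coe_mk, ha]
      exact min_eq_left (by positivity)
    · simp only [ContinuousMap.coe_mk, hb]
      exact min_eq_left (by positivity)
    · have hk : 0 < |F k y| := abs_pos.mpr (hF k y hy)
      refine ⟨lt_min (hg y hy).1 (by positivity), fun l hl => ?_⟩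
      rcases Finset.mem_insert.mp hl with rfl | hl
      · exact (min_le_right _ _).trans_lt (by linarith)
      · exact (min_le_left _ _).trans_lt ((hg y hy).2 l hl)

theorem Fin.exists_succ_le_lt {n : ℕ} (Y : Fin n → ℝ) {a b : Fin n} {y : ℝ} (hY : StrictMono Y)
    (ha : Y a ≤ y) (hb : y < Y b) : ∃ i j : Fin n, (j : ℕ) = i + 1 ∧ Y i ≤ y ∧ y < Y j := by
  obtain ⟨i, hi, hmax⟩ := (toFinite {k : Fin n | Y k ≤ y}).exists_maximal ⟨a, ha⟩
  have hib : i < b := hY.lt_iff_lt.mp (lt_of_le_of_lt hi hb)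
  refine ⟨i, ⟨i + 1, by omega⟩, rfl, hi, ?_⟩
  by_contra! h
  have := hmax (y := ⟨i + 1, by omega⟩) h (Fin.le_def.mpr (by simp))
  simp [Fin.le_def] at this

/-- Any choice of `r`-related elements is injective, since `r` recovers `a` from `b`. -/
theorem Set.encard_le_encard_of_choice {α β : Type*} {s : Set α} {t : Set β} {r : α → β → Prop}
    (h : ∀ a ∈ s, ∃ b ∈ t, r a b)
    (hr : ∀ a ∈ s, ∀ a' ∈ s, ∀ b, r a b → r a' b → a = a') : s.encard ≤ t.encard := by
  choose F hF hF' using h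
  refine Function.Embedding.encard_le ⟨fun a : s => ⟨F a.1 a.2, hF a.1 a.2⟩, fun a a' heq => ?_⟩
  refine Subtype.ext (hr _ a.2 _ a'.2 _ (hF' _ a.2) ?_)
  rw [Subtype.mk.inj heq]
  exact hF' _ a'.2

theorem Metric.isBounded_iff_isCompact_closure {X : Type*} [PseudoMetricSpace X] [ProperSpace X]
    {s : Set X} : Bornology.IsBounded s ↔ IsCompact (closure s) :=
  ⟨fun h => h.isCompact_closure, fun h => h.isBounded.subset subset_closure⟩

/-- Boundedness becomes topological in proper spaces; hence homeomorphisms preserve external faces.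
-/
theorem Homeomorph.isBounded_image_iff {X Y : Type*} [PseudoMetricSpace X] [ProperSpace X]
    [PseudoMetricSpace Y] [ProperSpace Y] (Φ : X ≃ₜ Y) (s : Set X) :
    Bornology.IsBounded (Φ '' s) ↔ Bornology.IsBounded s := by
  rw [Metric.isBounded_iff_isCompact_closure, Metric.isBounded_iff_isCompact_closure,
    ← Φ.image_closure, Φ.isCompact_image]

/-- The homeomorphism of the plane that straightens the graph `x = h y`. -/
def Homeomorph.shear (h : C(ℝ, ℝ)) : ℝ × ℝ ≃ₜ ℝ × ℝ where
  toFun p := (p.1 - h p.2, p.2)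
  invFun p := (p.1 + h p.2, p.2)
  left_inv p := by simp
  right_inv p := by simp
  continuous_toFun := by fun_prop
  continuous_invFun := by fun_prop

/-! ### Drawings under homeomorphisms, and upward edges as graphs over the height -/

namespace Digraph.Drawing

variable {V : Type*} {G : Digraph V}

theorem SameFaces.trans {Γ Δ Θ : G.Drawing} (h₁ : Γ.SameFaces Δ) (h₂ : Δ.SameFaces Θ) :
    Γ.SameFaces Θ := by
  obtain ⟨σ, hσ⟩ := h₁
  obtain ⟨τ, hτ⟩ := h₂
  exact ⟨σ.trans τ, fun F => ⟨(hτ _).1.trans (hσ F).1, (hτ _).2.1.trans (hσ F).2.1,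
    (hτ _).2.2.trans (hσ F).2.2⟩⟩

theorem SameFaces.symm {Γ Δ : G.Drawing} (h : Γ.SameFaces Δ) : Δ.SameFaces Γ := by
  obtain ⟨σ, hσ⟩ := h
  refine ⟨σ.symm, fun F => ?_⟩
  have := hσ (σ.symm F)
  rw [Equiv.apply_symm_apply] at this
  exact ⟨this.1.symm, this.2.1.symm, this.2.2.symm⟩

/-- The image of a drawing under a homeomorphism of the plane. -/
def map (Γ : G.Drawing) (Φ : Plane ≃ₜ Plane) : G.Drawing where
  point v := Φ (Γ.point v)
  curve e := (Φ : C(Plane, Plane)).comp (Γ.curve e)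
  point_injective := Φ.injective.comp Γ.point_injective
  curve_zero e := congrArg Φ (Γ.curve_zero e)
  curve_one e := congrArg Φ (Γ.curve_one e)
  curve_injective e := Φ.injective.comp (Γ.curve_injective e)
  curve_avoids e w τ h := Γ.curve_avoids e w τ (Φ.injective h)

theorem openArc_map (Γ : G.Drawing) (Φ : Plane ≃ₜ Plane) (e : G.Edge) :
    (Γ.map Φ).openArc e = Φ '' Γ.openArc e :=
  image_comp Φ (Γ.curve e) _

theorem range_curve_map (Γ : G.Drawing) (Φ : Plane ≃ₜ Plane) (e : G.Edge) :
    range ((Γ.map Φ).curve e) = Φ '' range (Γ.curve e) :=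
  range_comp Φ (Γ.curve e)

theorem support_map (Γ : G.Drawing) (Φ : Plane ≃ₜ Plane) :
    (Γ.map Φ).support = Φ '' Γ.support := by
  simp only [support, image_union, image_iUnion, range_curve_map]
  congr 1
  exact range_comp Φ Γ.point

theorem IsPlanar.map {Γ : G.Drawing} (h : Γ.IsPlanar) (Φ : Plane ≃ₜ Plane) :
    (Γ.map Φ).IsPlanar := fun e f hef => by
  rw [openArc_map, openArc_map, disjoint_image_iff Φ.injective]
  exact h e f hef

theorem image_mem_faces_map {Γ : G.Drawing} (Φ : Plane ≃ₜ Plane) {F : Set Plane}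
    (hF : F ∈ Γ.faces) : Φ '' F ∈ (Γ.map Φ).faces := by
  obtain ⟨p, hp, rfl⟩ := hF
  have hc : (Γ.map Φ).supportᶜ = Φ '' Γ.supportᶜ := by
    rw [support_map, image_compl_eq Φ.bijective]
  refine ⟨Φ p, hc ▸ mem_image_of_mem Φ hp, ?_⟩
  rw [hc, Φ.image_connectedComponentIn hp]

theorem map_symm_map (Γ : G.Drawing) (Φ : Plane ≃ₜ Plane) : (Γ.map Φ).map Φ.symm = Γ := by
  cases Γ
  simp only [map, mk.injEq]
  refine ⟨by ext <;> simp, ?_⟩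
  ext <;> simp

theorem sameFaces_map (Γ : G.Drawing) (Φ : Plane ≃ₜ Plane) : Γ.SameFaces (Γ.map Φ) := by
  refine ⟨{ toFun := fun F => ⟨Φ '' F, image_mem_faces_map Φ F.2⟩
            invFun := fun F => ⟨Φ.symm '' F, by
              have := image_mem_faces_map Φ.symm F.2
              rwa [map_symm_map] at this⟩
            left_inv := fun F => Subtype.ext (Φ.toEquiv.symm_image_image F)
            right_inv := fun F => Subtype.ext (Φ.toEquiv.image_symm_image F) }, fun F => ?_⟩
  refine ⟨?_, ?_, Φ.isBounded_image_iff _⟩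
  · ext v
    change Φ (Γ.point v) ∈ frontier (Φ '' F) ↔ _
    rw [← Φ.image_frontier, Φ.injective.mem_set_image]
    rfl
  · ext e
    change range ((Γ.map Φ).curve e) ⊆ frontier (Φ '' F) ↔ _
    rw [← Φ.image_frontier, range_curve_map, image_subset_image_iff Φ.injective]
    rfl

theorem point_notMem_openArc (Γ : G.Drawing) (e : G.Edge) (w : V) : Γ.point w ∉ Γ.openArc e := by
  rintro ⟨τ, hτ, h⟩
  rcases Γ.curve_avoids e w τ h with rfl | rfl
  · exact lt_irrefl _ hτ.1
  · exact lt_irrefl _ hτ.2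

theorem IsUpward.tail_lt_head {Γ : G.Drawing} (h : Γ.IsUpward) (e : G.Edge) :
    (Γ.point e.1.1).2 < (Γ.point e.1.2).2 := by
  have := h e (zero_lt_one (α := unitInterval))
  simpa only [Γ.curve_zero, Γ.curve_one] using this

theorem IsUpward.snd_mem_Ioo {Γ : G.Drawing} (h : Γ.IsUpward) {e : G.Edge} {p : Plane}
    (hp : p ∈ Γ.openArc e) : p.2 ∈ Ioo (Γ.point e.1.1).2 (Γ.point e.1.2).2 := by
  obtain ⟨τ, hτ, rfl⟩ := hp
  rw [← Γ.curve_zero, ← Γ.curve_one]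
  exact ⟨h e hτ.1, h e hτ.2⟩

theorem IsUpward.acyclic {Γ : G.Drawing} (h : Γ.IsUpward) : G.Acyclic := by
  have key : ∀ u w, Relation.TransGen G.Adj u w → (Γ.point u).2 < (Γ.point w).2 := by
    intro u w huw
    induction huw with
    | single hab => exact h.tail_lt_head ⟨(_, _), hab⟩
    | tail _ hab ih => exact ih.trans (h.tail_lt_head ⟨(_, _), hab⟩)
  exact fun u hu => lt_irrefl _ (key u u hu)

/-- An upward edge is the graph of a continuous function of the height. -/
theorem IsUpward.exists_graph {Γ : G.Drawing} (h : Γ.IsUpward) (e : G.Edge) :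
    ∃ X : C(ℝ, ℝ), X (Γ.point e.1.1).2 = (Γ.point e.1.1).1 ∧
      X (Γ.point e.1.2).2 = (Γ.point e.1.2).1 ∧ (∀ p ∈ Γ.openArc e, p.1 = X p.2) ∧
      ∀ y ∈ Ioo (Γ.point e.1.1).2 (Γ.point e.1.2).2, (X y, y) ∈ Γ.openArc e := by
  obtain ⟨X, hX⟩ := (isCompact_range (Γ.curve e).continuous).exists_continuous_eq_fst (by
    rintro _ ⟨τ, rfl⟩ _ ⟨τ', rfl⟩ heq
    rw [(h e).injective heq])
  have h0 := hX _ (mem_range_self 0)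
  have h1 := hX _ (mem_range_self 1)
  rw [Γ.curve_zero] at h0
  rw [Γ.curve_one] at h1
  refine ⟨X, h0, h1, ?_, fun y hy => ?_⟩
  · rintro _ ⟨τ, -, rfl⟩
    exact (hX _ (mem_range_self τ)).symm
  · have hc : ContinuousOn (fun τ => (Γ.curve e τ).2) (Icc 0 1) := by fun_prop
    have := intermediate_value_Ioo (zero_le_one (α := unitInterval)) hc
    simp only [Γ.curve_zero, Γ.curve_one] at this
    obtain ⟨τ, hτ, rfl⟩ := this hy
    refine ⟨τ, hτ, Prod.ext (hX _ (mem_range_self τ)).symm rfl⟩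

/-! ### From HP-completions to book embeddings -/

section HPToBook

variable {C : Digraph V} {Γ₀ : G.Drawing} {s t : V} {n : ℕ} {v : Fin n ≃ V}
  {Γ : (G ⊔ C).Drawing}

theorem IsHPDrawing.strictMono (h : IsHPDrawing Γ₀ s t v C Γ) :
    StrictMono fun i => (Γ.point (v i)).2 := by
  cases n with
  | zero => exact fun i => i.elim0
  | succ m =>
    refine Fin.strictMono_iff_lt_succ.mpr fun i => ?_
    exact h.upward.tail_lt_head ⟨(_, _), h.completion.hamiltonian.adj i.castSucc i.succ (by simp)⟩

/-- Next to each edge of the Hamiltonian path there is a curve that meets edges of `G` only at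
crossings of the drawing. -/
theorem IsHPDrawing.exists_spine_piece [Finite V] (h : IsHPDrawing Γ₀ s t v C Γ) (i j : Fin n)
    (hij : (j : ℕ) = i + 1) :
    ∃ g : C(ℝ, ℝ), g (Γ.point (v i)).2 = (Γ.point (v i)).1 ∧
      g (Γ.point (v j)).2 = (Γ.point (v j)).1 ∧
      ∀ y ∈ Ioo (Γ.point (v i)).2 (Γ.point (v j)).2, ∀ f : (G ⊔ C).Edge, G.Adj f.1.1 f.1.2 →
        (g y, y) ∈ Γ.openArc f → ∃ z ∈ Γ.crossings, z.2 = (g y, y) := by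
  choose X hX0 hX1 hXe hXy using h.upward.exists_graph
  let e : (G ⊔ C).Edge := ⟨(v i, v j), h.completion.hamiltonian.adj i j hij⟩
  by_cases hG : G.Adj (v i) (v j)
  -- These edges of `G` cross the whole strip between the two heights, and by planarity never meet
  -- `e` inside it.
  · let ι := {f : (G ⊔ C).Edge // G.Adj f.1.1 f.1.2 ∧ f ≠ e ∧
      (Γ.point f.1.1).2 ≤ (Γ.point (v i)).2 ∧ (Γ.point (v j)).2 ≤ (Γ.point f.1.2).2}
    have hι : Finite ι := inferInstance
    obtain ⟨g, ha, hb, hg⟩ := exists_continuous_pos_lt_abs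
      (a := (Γ.point (v i)).2) (b := (Γ.point (v j)).2) (fun f : ι => X f.1 - X e) (by
        rintro ⟨f, hfG, hfe, hf1, hf2⟩ y hy hzero
        have h1 := hXy e y hy
        have h2 := hXy f y ⟨hf1.trans_lt hy.1, hy.2.trans_le hf2⟩
        rw [sub_eq_zero.mp hzero] at h2
        exact disjoint_left.mp (h.preserves.1 ⟨f.1, hfG⟩ ⟨e.1, hG⟩
          (fun heq => hfe (Subtype.ext (Subtype.mk.inj heq)))) h2 h1)
    refine ⟨X e + g, by simp [ha, hX0 e, e], by simpa [hb] using hX1 e, fun y hy f hfG hf => ?_⟩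
    exfalso
    have hXf : (X e + g) y = X f y := hXe f _ hf
    have hyf := h.upward.snd_mem_Ioo hf
    rw [ContinuousMap.add_apply] at hXf
    by_cases hfe : f = e
    · have := (hg y hy).1
      rw [hfe] at hXf
      linarith
    -- No vertex lies strictly inside the strip, so an edge reaching height `y` spans the strip and
    -- belongs to `ι`.
    · have hf1 : (Γ.point f.1.1).2 ≤ (Γ.point (v i)).2 := by
        obtain ⟨k, hk⟩ := v.surjective f.1.1
        have hkj : k < j := h.strictMono.lt_iff_lt.mp (by
          simpa only [hk] using hyf.1.trans hy.2)
        rw [← hk]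
        exact h.strictMono.monotone (Fin.le_def.mpr (by have := Fin.lt_def.mp hkj; omega))
      have hf2 : (Γ.point (v j)).2 ≤ (Γ.point f.1.2).2 := by
        obtain ⟨k, hk⟩ := v.surjective f.1.2
        have hki : i < k := h.strictMono.lt_iff_lt.mp (by
          simpa only [hk] using hy.1.trans hyf.2)
        rw [← hk]
        exact h.strictMono.monotone (Fin.le_def.mpr (by have := Fin.lt_def.mp hki; omega))
      have h1 := (hg y hy).2 ⟨f, hfG, hfe, hf1, hf2⟩
      have h2 := (hg y hy).1
      rw [ContinuousMap.sub_apply, ← hXf, add_sub_cancel_left, abs_of_pos h2] at h1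
      exact lt_irrefl _ h1
  · refine ⟨X e, hX0 e, hX1 e, fun y hy f hfG hf => ⟨(s(e, f), _), ⟨e, f, ?_, rfl, ?_, hf⟩, rfl⟩⟩
    · rintro rfl
      exact hG hfG
    · exact hXy e y hy

/-- A curve through all vertices that is the graph of a function of the height and meets edges
of `G` only at vertices and crossings. -/
theorem IsHPDrawing.exists_spine [Finite V] (h : IsHPDrawing Γ₀ s t v C Γ) :
    ∃ x : C(ℝ, ℝ), (∀ u, x (Γ.point u).2 = (Γ.point u).1) ∧
      ∀ f : (G ⊔ C).Edge, G.Adj f.1.1 f.1.2 → ∀ p ∈ Γ.openArc f, x p.2 = p.1 →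
        ∃ z ∈ Γ.crossings, z.2 = p := by
  choose g hg0 hg1 hg using fun q : {q : Fin n × Fin n // (q.2 : ℕ) = q.1 + 1} =>
    h.exists_spine_piece q.1.1 q.1.2 q.2
  have hmono := h.strictMono
  let S : {q : Fin n × Fin n // (q.2 : ℕ) = q.1 + 1} → Set Plane := fun q =>
    (fun y => (g q y, y)) '' Icc (Γ.point (v q.1.1)).2 (Γ.point (v q.1.2)).2
  -- The vertices are listed separately because a single vertex has no pieces.
  have hK : IsCompact (range Γ.point ∪ ⋃ q, S q) :=
    (finite_range _).isCompact.union (isCompact_iUnion fun q =>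
      isCompact_Icc.image (by fun_prop))
  have hvertex : ∀ k q, (Γ.point (v k)).2 ∈ Icc (Γ.point (v q.1.1)).2 (Γ.point (v q.1.2)).2 →
      g q (Γ.point (v k)).2 = (Γ.point (v k)).1 := by
    intro k q hk
    have h1 := Fin.le_def.mp (hmono.le_iff_le.mp hk.1)
    have h2 := Fin.le_def.mp (hmono.le_iff_le.mp hk.2)
    have h3 := q.2
    by_cases hk1 : k = q.1.1
    · rw [hk1, hg0]
    · have : k = q.1.2 := by
        rw [Fin.ext_iff] at hk1 ⊢
        omega
      rw [this, hg1]
  have hpiece : ∀ q r : {q : Fin n × Fin n // (q.2 : ℕ) = q.1 + 1}, q.1.1 < r.1.1 → ∀ y,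
      y ∈ Icc (Γ.point (v q.1.1)).2 (Γ.point (v q.1.2)).2 →
      y ∈ Icc (Γ.point (v r.1.1)).2 (Γ.point (v r.1.2)).2 → g q y = g r y := by
    intro q r hqr y hyq hyr
    have hle : q.1.2 ≤ r.1.1 := Fin.le_def.mpr (by have := q.2; have := Fin.lt_def.mp hqr; omega)
    have hy : y = (Γ.point (v q.1.2)).2 :=
      le_antisymm hyq.2 ((hmono.monotone hle).trans hyr.1)
    subst hy
    rw [hg1, hvertex _ _ hyr]
  have hinj : InjOn Prod.snd (range Γ.point ∪ ⋃ q, S q) := by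
    have hvS : ∀ u q, ∀ p ∈ S q, (Γ.point u).2 = p.2 → Γ.point u = p := by
      rintro u q _ ⟨y, hy, rfl⟩ (heq : _ = y)
      obtain ⟨k, rfl⟩ := v.surjective u
      subst heq
      exact Prod.ext (hvertex k q hy).symm rfl
    rintro p (⟨u, rfl⟩ | hp) p' (⟨u', rfl⟩ | hp') heq
    · obtain ⟨k, rfl⟩ := v.surjective u
      obtain ⟨k', rfl⟩ := v.surjective u'
      rw [hmono.injective heq]
    · obtain ⟨q, hq⟩ := mem_iUnion.mp hp'
      exact hvS _ _ _ hq heq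
    · obtain ⟨q, hq⟩ := mem_iUnion.mp hp
      exact (hvS _ _ _ hq heq.symm).symm
    · obtain ⟨q, y, hy, rfl⟩ := mem_iUnion.mp hp
      obtain ⟨r, y', hy', rfl⟩ := mem_iUnion.mp hp'
      obtain rfl : y = y' := heq
      refine Prod.ext ?_ rfl
      rcases lt_trichotomy q.1.1 r.1.1 with hlt | heq | hlt
      · exact hpiece q r hlt y hy hy'
      · have : q = r := Subtype.ext (Prod.ext heq (Fin.ext (by rw [q.2, r.2, heq])))
        rw [this]
      · exact (hpiece r q hlt y hy' hy).symm
  obtain ⟨x, hx⟩ := hK.exists_continuous_eq_fst hinj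
  have hxv : ∀ u, x (Γ.point u).2 = (Γ.point u).1 := fun u => hx _ (Or.inl (mem_range_self u))
  refine ⟨x, hxv, fun f hfG p hp hxp => ?_⟩
  obtain ⟨a, ha⟩ := v.surjective f.1.1
  obtain ⟨b, hb⟩ := v.surjective f.1.2
  have hpf := h.upward.snd_mem_Ioo hp
  rw [← ha, ← hb] at hpf
  obtain ⟨i, j, hij, hi, hj⟩ := Fin.exists_succ_le_lt _ hmono hpf.1.le hpf.2
  have hne : (Γ.point (v i)).2 ≠ p.2 := fun heq => by
    refine Γ.point_notMem_openArc f (v i) ?_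
    have : Γ.point (v i) = p := Prod.ext (by rw [← hxv, heq, hxp]) heq
    rwa [this]
  have hgp : (g ⟨(i, j), hij⟩ p.2, p.2) = p := by
    refine Prod.ext ?_ rfl
    rw [← hxp]
    exact (hx _ (Or.inr (mem_iUnion.mpr ⟨⟨(i, j), hij⟩, p.2, ⟨hi, hj.le⟩, rfl⟩))).symm
  have := hg ⟨(i, j), hij⟩ p.2 ⟨lt_of_le_of_ne hi hne, hj⟩ f hfG
  rw [hgp] at this
  exact this hp

theorem IsHPDrawing.exists_bookEmbedding [Finite V] (h : IsHPDrawing Γ₀ s t v C Γ) :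
    ∃ Δ : G.Drawing, IsUpwardBookEmbedding Γ₀ Δ ∧ Δ.HasSpineOrder v ∧
      Δ.spineCrossings.encard ≤ Γ.crossings.encard := by
  obtain ⟨x, hxv, hx⟩ := h.exists_spine
  let Φ : Plane ≃ₜ Plane := Homeomorph.shear x
  let Δ := (Γ.restrict (le_sup_left : G ≤ G ⊔ C)).map Φ
  have hplanar : Δ.IsPlanar := h.preserves.1.map Φ
  refine ⟨Δ, ⟨fun u => sub_eq_zero.mpr (hxv u).symm, fun e => h.upward ⟨e.1, Or.inl e.2⟩, hplanar,
    (sameFaces_map _ Φ).symm.trans h.preserves.2⟩, h.strictMono, ?_⟩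
  have key : ∀ w ∈ Δ.spineCrossings, ∃ z ∈ Γ.crossings, Φ z.2 = w.2 := by
    rintro ⟨e, _⟩ ⟨hw, hw0⟩
    rw [openArc_map] at hw
    obtain ⟨p, hp, rfl⟩ := hw
    obtain ⟨z, hz, rfl⟩ := hx ⟨e.1, Or.inl e.2⟩ e.2 p hp (sub_eq_zero.mp hw0).symm
    exact ⟨z, hz, rfl⟩
  -- The point of a spine crossing determines its edge, by planarity.
  refine encard_le_encard_of_choice key fun w hw w' hw' z h1 h2 => ?_
  have h2 : w.2 = w'.2 := by rw [← h1, ← h2]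
  refine Prod.ext ?_ h2
  by_contra hne
  exact disjoint_left.mp (hplanar _ _ hne) hw.1 (h2 ▸ hw'.1)

end HPToBook

/-! ### From book embeddings to HP-completions -/

section BookToHP

/-- The pairs of consecutive vertices of an ordering that are not adjacent. -/
def _root_.Digraph.missingPath (G : Digraph V) {n : ℕ} (v : Fin n ≃ V) : Digraph V where
  Adj u w := (∃ i j : Fin n, (j : ℕ) = i + 1 ∧ v i = u ∧ v j = w) ∧ ¬ G.Adj u w

variable {Γ₀ Δ : G.Drawing} {s t : V} {n : ℕ} {v : Fin n ≃ V}

/-- The straight segment between two points of the plane. -/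
def segmentCurve (p q : Plane) : C(unitInterval, Plane) where
  toFun τ := (p.1 + τ * (q.1 - p.1), p.2 + τ * (q.2 - p.2))

theorem strictMono_segmentCurve {p q : Plane} (h : p.2 < q.2) :
    StrictMono fun τ => (segmentCurve p q τ).2 := fun τ τ' hτ => by
  have : (τ : ℝ) < τ' := hτ
  change p.2 + τ * (q.2 - p.2) < p.2 + τ' * (q.2 - p.2)
  nlinarith

theorem fst_segmentCurve {p q : Plane} (hp : p.1 = 0) (hq : q.1 = 0) (τ : unitInterval) :
    (segmentCurve p q τ).1 = 0 := by
  simp [segmentCurve, hp, hq]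

theorem segmentCurve_zero (p q : Plane) : segmentCurve p q 0 = p := by simp [segmentCurve]

theorem segmentCurve_one (p q : Plane) : segmentCurve p q 1 = q := by simp [segmentCurve]

open Classical in
/-- The edges of a drawing together with straight segments between consecutive vertices. -/
noncomputable def addSpine (hv : Δ.HasSpineOrder v) : (G ⊔ G.missingPath v).Drawing where
  point := Δ.point
  curve e := if h : G.Adj e.1.1 e.1.2 then Δ.curve ⟨e.1, h⟩ else
    segmentCurve (Δ.point e.1.1) (Δ.point e.1.2)
  point_injective := Δ.point_injective
  curve_zero e := by
    split_ifs with h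
    · exact Δ.curve_zero _
    · exact segmentCurve_zero _ _
  curve_one e := by
    split_ifs with h
    · exact Δ.curve_one _
    · exact segmentCurve_one _ _
  curve_injective e := by
    split_ifs with h
    · exact Δ.curve_injective _
    · obtain ⟨⟨i, j, hij, hi, hj⟩, -⟩ := e.2.resolve_left h
      refine (strictMono_segmentCurve ?_).injective.of_comp (f := Prod.snd)
      rw [← hi, ← hj]
      exact hv (Fin.lt_def.mpr (by omega))
  curve_avoids e w τ := by
    split_ifs with h
    · exact Δ.curve_avoids _ w τ
    · intro heq
      obtain ⟨⟨i, j, hij, hi, hj⟩, -⟩ := e.2.resolve_left h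
      obtain ⟨k, rfl⟩ := v.surjective w
      have hmono := strictMono_segmentCurve
        (hv (show i < j from Fin.lt_def.mpr (by omega)))
      rw [← hi, ← hj] at heq
      by_contra! hτ
      -- An interior vertex would have an index strictly between `i` and `i + 1`.
      have h0 := hmono (unitInterval.pos_iff_ne_zero.mpr hτ.1)
      have h1 := hmono (unitInterval.lt_one_iff_ne_one.mpr hτ.2)
      simp only [heq, segmentCurve_zero, segmentCurve_one] at h0 h1
      have h2 := Fin.lt_def.mp (hv.lt_iff_lt.mp h0)
      have h3 := Fin.lt_def.mp (hv.lt_iff_lt.mp h1)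
      omega

theorem addSpine_curve_of_adj (hv : Δ.HasSpineOrder v)
    {e : (G ⊔ G.missingPath v).Edge} (he : G.Adj e.1.1 e.1.2) :
    (addSpine hv).curve e = Δ.curve ⟨e.1, he⟩ :=
  dif_pos he

theorem addSpine_curve_of_not_adj (hv : Δ.HasSpineOrder v)
    {e : (G ⊔ G.missingPath v).Edge} (he : ¬ G.Adj e.1.1 e.1.2) :
    (addSpine hv).curve e = segmentCurve (Δ.point e.1.1) (Δ.point e.1.2) :=
  dif_neg he

theorem addSpine_restrict (hv : Δ.HasSpineOrder v) :
    (addSpine hv).restrict (le_sup_left : G ≤ G ⊔ G.missingPath v) = Δ := by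
  have : ∀ e : G.Edge, (addSpine hv).curve
      ⟨e.1, (le_sup_left : G ≤ G ⊔ G.missingPath v) e.2⟩ = Δ.curve e :=
    fun e => addSpine_curve_of_adj hv e.2
  cases Δ
  simp only [restrict, mk.injEq]
  exact ⟨rfl, funext this⟩

theorem addSpine_isUpward (hv : Δ.HasSpineOrder v) (hΔ : Δ.IsUpward) :
    (addSpine hv).IsUpward := fun e => by
  by_cases h : G.Adj e.1.1 e.1.2
  · rw [addSpine_curve_of_adj hv h]
    exact hΔ _
  · rw [addSpine_curve_of_not_adj hv h]
    obtain ⟨⟨i, j, hij, hi, hj⟩, -⟩ := e.2.resolve_left h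
    rw [← hi, ← hj]
    exact strictMono_segmentCurve (hv (Fin.lt_def.mpr (by omega)))

/-- Nothing lies below the first vertex or above the last, so they are a source and a sink. -/
theorem HasSpineOrder.isHamiltonianPath (hv : Δ.HasSpineOrder v) (hΔ : Δ.IsUpward)
    (hs : ∀ u, G.IsSource u → u = s) (ht : ∀ u, G.IsSink u → u = t) :
    (G ⊔ G.missingPath v).IsHamiltonianPath s t v where
  adj i j hij := by
    by_cases h : G.Adj (v i) (v j)
    · exact Or.inl h
    · exact Or.inr ⟨⟨i, j, hij, rfl, rfl⟩, h⟩
  first i hi := hs _ fun u hu => by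
    obtain ⟨k, rfl⟩ := v.surjective u
    have := Fin.lt_def.mp (hv.lt_iff_lt.mp (hΔ.tail_lt_head ⟨(_, _), hu⟩))
    omega
  last i hi := ht _ fun u hu => by
    obtain ⟨k, rfl⟩ := v.surjective u
    have := Fin.lt_def.mp (hv.lt_iff_lt.mp (hΔ.tail_lt_head ⟨(_, _), hu⟩))
    omega

theorem IsUpwardBookEmbedding.isHPDrawing_addSpine (h : IsUpwardBookEmbedding Γ₀ Δ)
    (hv : Δ.HasSpineOrder v) (hs : ∀ u, G.IsSource u → u = s) (ht : ∀ u, G.IsSink u → u = t) :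
    IsHPDrawing Γ₀ s t v (G.missingPath v) (addSpine hv) where
  completion :=
    { new := fun _ _ huw => huw.2
      acyclic := (addSpine_isUpward hv h.upward).acyclic
      hamiltonian := hv.isHamiltonianPath h.upward hs ht
      on_path := fun _ _ huw => huw.1 }
  upward := addSpine_isUpward hv h.upward
  preserves := by
    rw [Preserves, addSpine_restrict]
    exact ⟨h.planar, h.sameFaces⟩

/-- Distinct segments occupy disjoint open height intervals. -/
theorem addSpine_eq_of_mem_openArc (hv : Δ.HasSpineOrder v) (hΔ : Δ.IsUpward)
    {e f : (G ⊔ G.missingPath v).Edge} (he : ¬ G.Adj e.1.1 e.1.2)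
    (hf : ¬ G.Adj f.1.1 f.1.2) {p : Plane} (hpe : p ∈ (addSpine hv).openArc e)
    (hpf : p ∈ (addSpine hv).openArc f) : e = f := by
  have hup := addSpine_isUpward hv hΔ
  have h1 : p.2 ∈ Ioo (Δ.point e.1.1).2 (Δ.point e.1.2).2 := hup.snd_mem_Ioo hpe
  have h2 : p.2 ∈ Ioo (Δ.point f.1.1).2 (Δ.point f.1.2).2 := hup.snd_mem_Ioo hpf
  obtain ⟨⟨i, j, hij, hi, hj⟩, -⟩ := e.2.resolve_left he
  obtain ⟨⟨k, l, hkl, hk, hl⟩, -⟩ := f.2.resolve_left hf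
  rw [← hi, ← hj] at h1
  rw [← hk, ← hl] at h2
  have h3 := Fin.lt_def.mp (hv.lt_iff_lt.mp (h1.1.trans h2.2))
  have h4 := Fin.lt_def.mp (hv.lt_iff_lt.mp (h2.1.trans h1.2))
  obtain rfl : i = k := Fin.ext (by omega)
  obtain rfl : j = l := Fin.ext (by omega)
  exact Subtype.ext (Prod.ext (hi.symm.trans hk) (hj.symm.trans hl))

theorem IsUpwardBookEmbedding.encard_crossings_addSpine_le (h : IsUpwardBookEmbedding Γ₀ Δ)
    (hv : Δ.HasSpineOrder v) :
    (addSpine hv).crossings.encard ≤ Δ.spineCrossings.encard := by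
  -- The relation singles out `e` as the edge of `G` in the unordered pair; the point alone then
  -- determines the segment `f`.
  refine encard_le_encard_of_choice (r := fun z w => z.2 = w.2 ∧
    ∃ e f : (G ⊔ G.missingPath v).Edge, z.1 = s(e, f) ∧ e.1 = w.1.1 ∧ ¬ G.Adj f.1.1 f.1.2 ∧
      z.2 ∈ (addSpine hv).openArc f) ?_ ?_
  · have key : ∀ e f : (G ⊔ G.missingPath v).Edge, G.Adj e.1.1 e.1.2 → ¬ G.Adj f.1.1 f.1.2 → ∀ p,
        p ∈ (addSpine hv).openArc e → p ∈ (addSpine hv).openArc f →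
        ∃ w ∈ Δ.spineCrossings, p = w.2 ∧ e.1 = w.1.1 := by
      intro e f he hf p hpe hpf
      rw [openArc, addSpine_curve_of_adj _ he] at hpe
      rw [openArc, addSpine_curve_of_not_adj _ hf] at hpf
      obtain ⟨τ, -, hτ⟩ := hpf
      exact ⟨(⟨e.1, he⟩, p), ⟨hpe, hτ ▸ fst_segmentCurve (h.on_spine _) (h.on_spine _) τ⟩, rfl, rfl⟩
    rintro ⟨_, p⟩ ⟨e, f, hef, rfl, hpe, hpf⟩
    by_cases he : G.Adj e.1.1 e.1.2 <;> by_cases hf : G.Adj f.1.1 f.1.2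
    · exfalso
      rw [openArc, addSpine_curve_of_adj _ he] at hpe
      rw [openArc, addSpine_curve_of_adj _ hf] at hpf
      exact disjoint_left.mp (h.planar ⟨e.1, he⟩ ⟨f.1, hf⟩
        fun heq => hef (Subtype.ext (Subtype.mk.inj heq))) hpe hpf
    · obtain ⟨w, hw, h1, h2⟩ := key e f he hf p hpe hpf
      exact ⟨w, hw, h1, e, f, rfl, h2, hf, hpf⟩
    · obtain ⟨w, hw, h1, h2⟩ := key f e hf he p hpf hpe
      exact ⟨w, hw, h1, f, e, Sym2.eq_swap, h2, he, hpe⟩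
    · exact absurd (addSpine_eq_of_mem_openArc hv h.upward he hf hpe hpf) hef
  · rintro ⟨z, p⟩ - ⟨z', p'⟩ - w ⟨h1, e, f, hz, he, hf, hpf⟩ ⟨h1', e', f', hz', he', hf', hpf'⟩
    obtain rfl : p = p' := h1.trans h1'.symm
    obtain rfl : e = e' := Subtype.ext (he.trans he'.symm)
    obtain rfl := addSpine_eq_of_mem_openArc hv h.upward hf hf' hpf hpf'
    exact Prod.ext (hz.trans hz'.symm) rfl

/-- Book embeddings compete for the minimum without a prescribed order; points on the spine have
distinct heights and can be sorted. -/
theorem IsUpwardBookEmbedding.exists_hasSpineOrder (h : IsUpwardBookEmbedding Γ₀ Δ)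
    (v : Fin n ≃ V) : ∃ w : Fin n ≃ V, Δ.HasSpineOrder w := by
  let Y : Fin n → ℝ := fun i => (Δ.point (v i)).2
  refine ⟨(Tuple.sort Y).trans v, (Tuple.monotone_sort Y).strictMono_of_injective ?_⟩
  refine Function.Injective.comp (fun i j hij => ?_) (Tuple.sort Y).injective
  exact v.injective (Δ.point_injective (Prod.ext
    ((h.on_spine _).trans (h.on_spine _).symm) hij))

end BookToHP

end Digraph.Drawing

/-! ### Equality of the two minima -/

open Digraph.Drawing
theorem theorem4 {V : Type*} [Finite V] (G : Digraph V) (Γ₀ : G.Drawing) (s t : V)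
    (hG : Γ₀.IsPlanarST s t) (n : ℕ) (v : Fin n ≃ V) (c : ℕ) :
    (∃ (C : Digraph V) (Γ : (G ⊔ C).Drawing),
        Digraph.Drawing.IsOptimalHPDrawing Γ₀ s t v C Γ ∧ Γ.crossings.encard = c) ↔
      (∃ Γ : G.Drawing, Digraph.Drawing.IsOptimalBookEmbedding Γ₀ Γ ∧ Γ.HasSpineOrder v ∧
        Γ.spineCrossings.encard = c) := by
  have toHP : ∀ {Δ : G.Drawing} {w : Fin n ≃ V}, IsUpwardBookEmbedding Γ₀ Δ →
      Δ.HasSpineOrder w → ∃ (D : Digraph V) (Θ : (G ⊔ D).Drawing),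
        IsHPDrawing Γ₀ s t w D Θ ∧ Θ.crossings.encard ≤ Δ.spineCrossings.encard :=
    fun hΔ hw => ⟨_, _, hΔ.isHPDrawing_addSpine hw (fun u => (hG.source_iff u).mp)
      fun u => (hG.sink_iff u).mp, hΔ.encard_crossings_addSpine_le hw⟩
  constructor
  · rintro ⟨C, Γ, ⟨hΓ, hmin⟩, hc⟩
    obtain ⟨Δ, hΔ, hΔv, hle⟩ := hΓ.exists_bookEmbedding
    -- Each competitor, completed along its own spine order, is bounded below by `Γ`; taking `Θ = Δ`
    -- turns `hle` into equality.
    have hopt : ∀ Θ : G.Drawing, IsUpwardBookEmbedding Γ₀ Θ →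
        Γ.crossings.encard ≤ Θ.spineCrossings.encard := fun Θ hΘ => by
      obtain ⟨w, hw⟩ := hΘ.exists_hasSpineOrder v
      obtain ⟨D, Λ, hΛ, hΛle⟩ := toHP hΘ hw
      exact (hmin w D Λ hΛ).trans hΛle
    exact ⟨Δ, ⟨hΔ, fun Θ hΘ => hle.trans (hopt Θ hΘ)⟩, hΔv, (hle.antisymm (hopt Δ hΔ)).trans hc⟩
  · rintro ⟨Δ, ⟨hΔ, hmin⟩, hΔv, hc⟩
    obtain ⟨C, Γ, hΓ, hle⟩ := toHP hΔ hΔv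
    have hopt : ∀ (w : Fin n ≃ V) (D : Digraph V) (Λ : (G ⊔ D).Drawing),
        IsHPDrawing Γ₀ s t w D Λ → Δ.spineCrossings.encard ≤ Λ.crossings.encard :=
      fun w D Λ hΛ => by
        obtain ⟨Θ, hΘ, -, hΘle⟩ := hΛ.exists_bookEmbedding
        exact (hmin Θ hΘ).trans hΘle
    exact ⟨C, Γ, ⟨hΓ, fun w D Λ hΛ => hle.trans (hopt w D Λ hΛ)⟩,
      (hle.antisymm (hopt v C Γ hΓ)).trans hc⟩
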